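/- Let $\mathcal M'$ be a connected Riemann surface without boundary, let $\mathcal M\subseteq\mathcal M'$ be closed, and let the boundary $\partial(\mathcal M)$ of $\mathcal M$ be a nonempty closed subset of $\mathcal M'$ with $\mathrm{Fr}(\mathcal M)\subseteq\partial(\mathcal M)\subseteq\mathcal M$, where $\mathrm{Fr}$ is the topological frontier in $\mathcal M'$ (for instance, $\partial(\mathcal M)$ may be a locally finite family of pairwise disjoint closed curves and isolated points). Put $\mathrm{Int}(\mathcal M)=\mathcal M\setminus\partial(\mathcal M)$, and let $\mathbb R^3_1$ be $\mathbb R^3$ with the Lorentzian metric $\langle\,,\rangle=dx_1^2+dx_2^2-dx_3^2$. Let $X:\mathcal M\to\mathbb R^3_1$ be a proper conformal maximal immersion, that is, a proper continuous map that is smooth on $\mathrm{Int}(\mathcal M)$, such that on $\mathrm{Int}(\mathcal M)$ the induced metric is Riemannian (spacelike), is conformal to the complex structure, and $X$ has zero mean curvature; the points of $\partial(\mathcal M)$ may be singular. Suppose that, for some $\alpha\in\,]0,\pi/4[$, there is a compact set $K\subseteq\mathcal M$ such that $X(\mathcal M\setminus K)$ is contained in the conical region $$\mathcal W_\alpha=\{(x,x_3)\in\mathbb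 C\times\mathbb R\equiv\mathbb R^3\;:\;|x_3|\le\|x\|\tan\alpha\}.$$ Then $\mathcal M$ is relative parabolic: every bounded continuous function $f:\mathcal M\to\mathbb R$ that is harmonic on $\mathrm{Int}(\mathcal M)$ and vanishes on $\partial(\mathcal M)$ is identically zero. -/

import Mathlib

open scoped Manifold ContDiff

/-- The Lorentzian metric `dx₁² + dx₂² - dx₃²` on `ℝ³` (coordinates indexed by `0, 1, 2`). -/
def lorentz (v w : EuclideanSpace ℝ (Fin 3)) : ℝ :=
  v 0 * w 0 + v 1 * w 1 - v 2 * w 2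

/-- The Lorentzian vector product, characterized by `⟨v × w, x⟩ = det (v, w, x)`. -/
def lorentzCross (v w : EuclideanSpace ℝ (Fin 3)) : EuclideanSpace ℝ (Fin 3) :=
  !₂[v 1 * w 2 - v 2 * w 1, v 2 * w 0 - v 0 * w 2, -(v 0 * w 1 - v 1 * w 0)]

/-- Partial derivative in the direction `a` of a map on (an open subset of) the plane; the
coordinates are `z = u + i v`, so `a = 1` gives `∂/∂u` and `a = Complex.I` gives `∂/∂v`. -/
noncomputable def pderiv (a : ℂ) (Y : ℂ → EuclideanSpace ℝ (Fin 3)) (z : ℂ) :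
    EuclideanSpace ℝ (Fin 3) :=
  fderiv ℝ Y z a

/-- The induced metric (first fundamental form) of a parametrization `Y`. -/
noncomputable def firstForm (Y : ℂ → EuclideanSpace ℝ (Fin 3)) (z a b : ℂ) : ℝ :=
  lorentz (pderiv a Y z) (pderiv b Y z)

/-- The unit (`⟨N, N⟩ = -1`) normal of a spacelike parametrization `Y`. -/
noncomputable def unitNormal (Y : ℂ → EuclideanSpace ℝ (Fin 3)) (z : ℂ) :
    EuclideanSpace ℝ (Fin 3) :=
  let ν := lorentzCross (pderiv 1 Y z) (pderiv Complex.I Y z)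
  (Real.sqrt (-lorentz ν ν))⁻¹ • ν

/-- The second fundamental form of a spacelike parametrization `Y`. -/
noncomputable def secondForm (Y : ℂ → EuclideanSpace ℝ (Fin 3)) (z a b : ℂ) : ℝ :=
  lorentz (pderiv a (pderiv b Y) z) (unitNormal Y z)

/-- The mean curvature of a spacelike parametrization `Y` (half the trace of the second
fundamental form with respect to the induced metric). -/
noncomputable def meanCurvature (Y : ℂ → EuclideanSpace ℝ (Fin 3)) (z : ℂ) : ℝ :=
  (firstForm Y z 1 1 * secondForm Y z Complex.I Complex.I
      - 2 * firstForm Y z 1 Complex.I * secondForm Y z 1 Complex.I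
      + firstForm Y z Complex.I Complex.I * secondForm Y z 1 1) /
    (2 * (firstForm Y z 1 1 * firstForm Y z Complex.I Complex.I
      - firstForm Y z 1 Complex.I ^ 2))

/-- `M` is a surface with boundary `B`, sitting in the surface without boundary `S`: `M` is closed,
`B` is a closed subset of `M` and contains the topological frontier of `M`. Points of `B` that are
topologically interior to `M` are allowed, since isolated points may be declared boundary points.
The interior of the surface with boundary is `M \ B`, an open subset of `S`. -/
structure IsSurfaceWithBoundary {S : Type*} [TopologicalSpace S] (M B : Set S) : Prop where
  isClosed : IsClosed M
  isClosed_boundary : IsClosed B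
  boundary_subset : B ⊆ M
  frontier_subset : frontier M ⊆ B

/-- `X` is a conformal maximal immersion of the Riemann surface `M` with boundary `B` into
Lorentz-Minkowski space. No condition besides continuity is imposed at boundary points, which
may be singular. -/
structure IsConformalMaximalImmersion {S : Type*} [TopologicalSpace S] [ChartedSpace ℂ S]
    (M B : Set S) (X : S → EuclideanSpace ℝ (Fin 3)) : Prop where
  continuousOn : ContinuousOn X M
  smooth : ContMDiffOn 𝓘(ℝ, ℂ) 𝓘(ℝ, EuclideanSpace ℝ (Fin 3)) ∞ X (M \ B)
  /-- The induced metric on the interior is Riemannian. -/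
  spacelike : ∀ e ∈ atlas ℂ S, ∀ z ∈ e.target ∩ e.symm ⁻¹' (M \ B), ∀ a : ℂ, a ≠ 0 →
    0 < firstForm (X ∘ e.symm) z a a
  /-- Holomorphic coordinates are isothermal. -/
  conformal : ∀ e ∈ atlas ℂ S, ∀ z ∈ e.target ∩ e.symm ⁻¹' (M \ B),
    firstForm (X ∘ e.symm) z 1 1 = firstForm (X ∘ e.symm) z Complex.I Complex.I ∧
      firstForm (X ∘ e.symm) z 1 Complex.I = 0
  maximal : ∀ e ∈ atlas ℂ S, ∀ z ∈ e.target ∩ e.symm ⁻¹' (M \ B),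
    meanCurvature (X ∘ e.symm) z = 0

/-- A real function on a Riemann surface is harmonic on an open set `U`. -/
def IsHarmonicOnSurface {S : Type*} [TopologicalSpace S] [ChartedSpace ℂ S]
    (U : Set S) (f : S → ℝ) : Prop :=
  ∀ e ∈ atlas ℂ S, InnerProductSpace.HarmonicOnNhd (f ∘ e.symm) (e.target ∩ e.symm ⁻¹' U)

/-- The Riemann surface `M` with boundary `B` is relative parabolic: the only bounded harmonic
function (continuous up to the boundary) that vanishes on the boundary is zero. -/
def IsRelativeParabolic {S : Type*} [TopologicalSpace S] [ChartedSpace ℂ S]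
    (M B : Set S) : Prop :=
  ∀ f : S → ℝ, ContinuousOn f M → IsHarmonicOnSurface (M \ B) f →
    (∃ C : ℝ, ∀ p ∈ M, |f p| ≤ C) → (∀ p ∈ B, f p = 0) → ∀ p ∈ M, f p = 0

/-- The conical region `{(x, x₃) ∈ ℂ × ℝ : |x₃| ≤ ‖x‖ tan α}`. -/
def conicalRegion (α : ℝ) : Set (EuclideanSpace ℝ (Fin 3)) :=
  {x | |x 2| ≤ Real.sqrt (x 0 ^ 2 + x 1 ^ 2) * Real.tan α}

/-- A property holds eventually on `M` if it holds outside a compact subset of `M`. -/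
def EventuallyOn {S : Type*} [TopologicalSpace S] (M : Set S) (P : S → Prop) : Prop :=
  ∃ K ⊆ M, IsCompact K ∧ ∀ p ∈ M \ K, P p

/-! Put `q = ⟨X, X⟩`. In isothermal coordinates the immersion has conformal factor `l`, and zero
mean curvature makes its coordinates harmonic, so `Δq = 4l`. The normal is timelike, so the Gram
identity `lorentz_gram` gives `|∇q|² ≥ 4lq`. Hence `log q` is superharmonic where `q > 1`, and a
second logarithm makes `h = log (log q)` strictly superharmonic (`maximal_log_log_superharmonic`).
Strictness lets the elementary second derivative test exclude interior maxima of `f - εh`.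

Since `α < π/4`, `q` dominates a multiple of `‖X‖²` on the cone. With properness, `h` therefore
tends to infinity at the ideal boundary of `M`. Comparing `f` with `εh` and letting `ε → 0` shows
that a positive supremum of `f` is attained (`le_of_le_on_norm_le`). By the strong maximum principle
the set where it is attained is clopen in `S`. It misses the nonempty `B`, contradicting
connectedness. The same applies to `-f`. -/

open Filter Topology

/-! ### Second directional derivatives and maximum principles in the plane -/

/-- The Laplacian of a `C²` function in the plane is the sum of its pure second partials. -/
lemma laplacian_eq_second_partials {g : ℂ → ℝ} {z : ℂ} (hg : ContDiffAt ℝ 2 g z) :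
    Laplacian.laplacian g z = fderiv ℝ (fun w => fderiv ℝ g w 1) z 1 +
      fderiv ℝ (fun w => fderiv ℝ g w Complex.I) z Complex.I := by
  have hd : DifferentiableAt ℝ (fderiv ℝ g) z :=
    (hg.fderiv_right (m := 1) (by norm_num)).differentiableAt (by norm_num)
  have key : ∀ a : ℂ, fderiv ℝ (fun w => fderiv ℝ g w a) z a = fderiv ℝ (fderiv ℝ g) z a a := by
    intro a
    rw [fderiv_clm_apply hd (differentiableAt_const a)]
    simp
  rw [InnerProductSpace.laplacian_eq_iteratedFDeriv_complexPlane]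
  simp [iteratedFDeriv_two_apply, key]

/-- Second derivative test: at a local maximum every pure second derivative is nonpositive. -/
lemma IsLocalMax.second_partial_nonpos {g : ℂ → ℝ} {z : ℂ} (hmax : IsLocalMax g z)
    (hg : ContDiffAt ℝ 2 g z) (a : ℂ) : fderiv ℝ (fun w => fderiv ℝ g w a) z a ≤ 0 := by
  by_contra! hpos
  set line : ℝ → ℂ := fun t => z + t • a with hline
  have hl : ∀ t, HasDerivAt line a t := fun t => by
    have h := ((hasDerivAt_id t).smul_const a).const_add z
    rw [one_smul] at h
    exact h
  have hlc : Tendsto line (𝓝 0) (𝓝 z) := by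
    simpa [hline] using (hl 0).continuousAt.tendsto
  have hl0 : line 0 = z := by simp [hline]
  have hdiff : ∀ᶠ w in 𝓝 z, DifferentiableAt ℝ g w :=
    (hg.eventually (by simp)).mono fun w hw => hw.differentiableAt (by norm_num)
  have hd2 : DifferentiableAt ℝ (fun w => fderiv ℝ g w a) z :=
    ((hg.fderiv_right (m := 1) (by norm_num)).differentiableAt (by norm_num)).clm_apply
      (differentiableAt_const a)
  have h1 : deriv (g ∘ line) =ᶠ[𝓝 0] fun t => fderiv ℝ g (line t) a := by
    filter_upwards [hlc.eventually hdiff] with t ht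
    exact (ht.hasFDerivAt.comp_hasDerivAt t (hl t)).deriv
  have h2 : deriv (deriv (g ∘ line)) 0 = fderiv ℝ (fun w => fderiv ℝ g w a) z a := by
    rw [h1.deriv_eq]
    have hd2' : HasFDerivAt (fun w => fderiv ℝ g w a)
        (fderiv ℝ (fun w => fderiv ℝ g w a) z) (line 0) := by
      rw [hl0]; exact hd2.hasFDerivAt
    exact (hd2'.comp_hasDerivAt 0 (hl 0)).deriv
  have hmax' : IsLocalMax (g ∘ line) 0 := by
    have := hlc.eventually hmax
    simpa [IsLocalMax, IsMaxFilter, hl0] using this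
  have hcont : ContinuousAt (g ∘ line) 0 := by
    apply ContinuousAt.comp
    · rw [hl0]; exact hg.continuousAt
    · exact (hl 0).continuousAt
  -- A local maximum that is also a local minimum is locally constant, which forces the second
  -- derivative to vanish.
  have hmin : IsLocalMin (g ∘ line) 0 :=
    isLocalMin_of_deriv_deriv_pos (by rw [h2]; exact hpos) hmax'.deriv_eq_zero hcont
  have hconst : g ∘ line =ᶠ[𝓝 0] fun _ => (g ∘ line) 0 := by
    filter_upwards [hmax', hmin] with t h1 h2 using le_antisymm h1 h2
  have h3 : deriv (deriv (g ∘ line)) 0 = 0 := by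
    rw [hconst.deriv.deriv_eq]; simp
  rw [h2] at h3
  exact hpos.ne' h3

/-- A harmonic function minus a strictly superharmonic one has no local maximum. -/
lemma InnerProductSpace.HarmonicAt.not_isLocalMax_sub {f s : ℂ → ℝ} {z : ℂ}
    (hf : InnerProductSpace.HarmonicAt f z) (hs : ContDiffAt ℝ 2 s z)
    (hsl : Laplacian.laplacian s z < 0) {ε : ℝ} (hε : 0 < ε) : ¬ IsLocalMax (f - ε • s) z := by
  intro hmax
  have hεs : ContDiffAt ℝ 2 (ε • s) z := hs.const_smul ε
  have hgc : ContDiffAt ℝ 2 (f - ε • s) z := hf.1.sub hεs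
  have hlap := laplacian_eq_second_partials hgc
  rw [hf.1.laplacian_sub hεs, InnerProductSpace.laplacian_smul ε hs, hf.2.self_of_nhds,
    Pi.zero_apply, smul_eq_mul] at hlap
  linarith [hmax.second_partial_nonpos hgc 1, hmax.second_partial_nonpos hgc Complex.I,
    mul_neg_of_pos_of_neg hε hsl]

/-- Strong maximum principle, local form. -/
lemma InnerProductSpace.HarmonicAt.eventually_eq_of_isLocalMax {g : ℂ → ℝ} {z : ℂ}
    (hg : InnerProductSpace.HarmonicAt g z) (hmax : IsLocalMax g z) : ∀ᶠ w in 𝓝 z, g w = g z := by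
  obtain ⟨r, hr, hball⟩ := Metric.eventually_nhds_iff_ball.1 hg.eventually
  -- Locally `g = Re F` with `F` holomorphic, and `‖exp F‖ = exp g` reduces the claim to the maximum
  -- modulus principle.
  obtain ⟨F, hF, hre⟩ :=
    InnerProductSpace.HarmonicOnNhd.exists_analyticOnNhd_ball_re_eq (f := g) (z := z) (R := r) hball
  have hb : Metric.ball z r ∈ 𝓝 z := Metric.ball_mem_nhds z hr
  have hnorm : ∀ w ∈ Metric.ball z r, ‖Complex.exp (F w)‖ = Real.exp (g w) := fun w hw => by
    rw [Complex.norm_exp]; congr 1; exact hre hw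
  have hd : ∀ᶠ w in 𝓝 z, DifferentiableAt ℂ (fun w => Complex.exp (F w)) w := by
    filter_upwards [hb] with w hw using (hF w hw).differentiableAt.cexp
  have hm : IsLocalMax (norm ∘ fun w => Complex.exp (F w)) z := by
    filter_upwards [hb, hmax] with w hw hle
    simp only [Function.comp, hnorm w hw, hnorm z (Metric.mem_ball_self hr)]
    exact Real.exp_le_exp.2 hle
  filter_upwards [hb, Complex.eventually_eq_of_isLocalMax_norm hd hm] with w hw he
  have := congrArg norm he
  rw [hnorm w hw, hnorm z (Metric.mem_ball_self hr)] at this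
  exact Real.exp_injective this

/-- The second derivative of `φ ∘ q` in a fixed direction. -/
lemma fderiv_fderiv_comp {q : ℂ → ℝ} {φ φ' : ℝ → ℝ} {φ'' : ℝ} {z : ℂ} (hq : ContDiffAt ℝ 2 q z)
    (hφ : ∀ᶠ t in 𝓝 (q z), HasDerivAt φ (φ' t) t) (hφ' : HasDerivAt φ' φ'' (q z)) (a : ℂ) :
    fderiv ℝ (fun w => fderiv ℝ (fun w => φ (q w)) w a) z a =
      φ'' * (fderiv ℝ q z a) ^ 2 + φ' (q z) * fderiv ℝ (fun w => fderiv ℝ q w a) z a := by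
  have hdiff : ∀ᶠ w in 𝓝 z, DifferentiableAt ℝ q w :=
    (hq.eventually (by simp)).mono fun w hw => hw.differentiableAt (by norm_num)
  have hd2 : DifferentiableAt ℝ (fun w => fderiv ℝ q w a) z :=
    ((hq.fderiv_right (m := 1) (by norm_num)).differentiableAt (by norm_num)).clm_apply
      (differentiableAt_const a)
  have h1 : (fun w => fderiv ℝ (fun w => φ (q w)) w a) =ᶠ[𝓝 z]
      fun w => φ' (q w) * fderiv ℝ q w a := by
    filter_upwards [hdiff, hq.continuousAt.eventually hφ] with w hw hw'
    have := (hw'.comp_hasFDerivAt w hw.hasFDerivAt).fderiv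
    simp only [Function.comp_def] at this
    rw [this]; simp
  rw [h1.fderiv_eq]
  have h2 : HasFDerivAt (fun w => φ' (q w)) (φ'' • fderiv ℝ q z) z :=
    hφ'.comp_hasFDerivAt z (hdiff.self_of_nhds).hasFDerivAt
  have h3 : fderiv ℝ (fun w => φ' (q w) * fderiv ℝ q w a) z = _ := (h2.mul hd2.hasFDerivAt).fderiv
  rw [h3]
  simp
  ring

/-! ### Linear algebra of the Lorentzian metric -/

lemma lorentz_comm (v w : EuclideanSpace ℝ (Fin 3)) : lorentz v w = lorentz w v := by
  simp only [lorentz]; ring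

lemma lorentz_add_left (u v w : EuclideanSpace ℝ (Fin 3)) :
    lorentz (u + v) w = lorentz u w + lorentz v w := by
  simp only [lorentz, PiLp.add_apply]; ring

lemma lorentz_smul_right (c : ℝ) (v w : EuclideanSpace ℝ (Fin 3)) :
    lorentz v (c • w) = c * lorentz v w := by
  simp only [lorentz, PiLp.smul_apply, smul_eq_mul]; ring

lemma lorentzCross_self (a b : EuclideanSpace ℝ (Fin 3)) :
    lorentz (lorentzCross a b) (lorentzCross a b) =
      -(lorentz a a * lorentz b b - lorentz a b ^ 2) := by
  simp [lorentz, lorentzCross]; ring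

/-- The Gram determinant of `a, b, y` is `-det(a, b, y)²`. -/
lemma lorentz_gram (a b y : EuclideanSpace ℝ (Fin 3)) :
    lorentz y y * (lorentz a a * lorentz b b - lorentz a b ^ 2) =
      lorentz b b * lorentz y a ^ 2 - 2 * lorentz a b * lorentz y a * lorentz y b +
        lorentz a a * lorentz y b ^ 2 - lorentz y (lorentzCross a b) ^ 2 := by
  simp [lorentz, lorentzCross]; ring

/-- A nonzero Gram determinant makes `a`, `b`, `a × b` a basis. `expand` writes `w` in it; the minus
sign comes from `⟨a × b, a × b⟩ = -det`. -/
lemma eq_zero_of_lorentz_eq_zero {a b w : EuclideanSpace ℝ (Fin 3)}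
    (hdet : lorentz a a * lorentz b b - lorentz a b ^ 2 ≠ 0) (ha : lorentz w a = 0)
    (hb : lorentz w b = 0) (hn : lorentz w (lorentzCross a b) = 0) : w = 0 := by
  have expand : (lorentz a a * lorentz b b - lorentz a b ^ 2) • w =
      (lorentz b b * lorentz w a - lorentz a b * lorentz w b) • a +
      (lorentz a a * lorentz w b - lorentz a b * lorentz w a) • b -
      lorentz w (lorentzCross a b) • lorentzCross a b := by
    ext i
    fin_cases i <;> simp [lorentz, lorentzCross] <;> ring
  rw [ha, hb, hn] at expand
  simpa [hdet] using expand

/-- Product rule for the Lorentzian metric. -/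
lemma fderiv_lorentz {U V : ℂ → EuclideanSpace ℝ (Fin 3)} {z : ℂ} (hU : DifferentiableAt ℝ U z)
    (hV : DifferentiableAt ℝ V z) (a : ℂ) :
    fderiv ℝ (fun w => lorentz (U w) (V w)) z a =
      lorentz (fderiv ℝ U z a) (V z) + lorentz (U z) (fderiv ℝ V z a) := by
  have hcoord : ∀ {Y : ℂ → EuclideanSpace ℝ (Fin 3)}, DifferentiableAt ℝ Y z → ∀ i : Fin 3,
      HasFDerivAt (fun w => Y w i) ((EuclideanSpace.proj i).comp (fderiv ℝ Y z)) z :=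
    fun hY i => (EuclideanSpace.proj i : EuclideanSpace ℝ (Fin 3) →L[ℝ] ℝ).hasFDerivAt.comp z
      hY.hasFDerivAt
  have h := (((hcoord hU 0).mul (hcoord hV 0)).add ((hcoord hU 1).mul (hcoord hV 1))).sub
    ((hcoord hU 2).mul (hcoord hV 2))
  have h' : fderiv ℝ (fun w => lorentz (U w) (V w)) z = _ := h.fderiv
  rw [h']
  simp [lorentz]
  ring

lemma ContDiffAt.lorentz {n : WithTop ℕ∞} {U V : ℂ → EuclideanSpace ℝ (Fin 3)} {z : ℂ}
    (hU : ContDiffAt ℝ n U z) (hV : ContDiffAt ℝ n V z) :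
    ContDiffAt ℝ n (fun w => lorentz (U w) (V w)) z := by
  have hcoord : ∀ {Y : ℂ → EuclideanSpace ℝ (Fin 3)}, ContDiffAt ℝ n Y z → ∀ i : Fin 3,
      ContDiffAt ℝ n (fun w => Y w i) z :=
    fun hY i => (EuclideanSpace.proj i : EuclideanSpace ℝ (Fin 3) →L[ℝ] ℝ).contDiff.contDiffAt.comp
      z hY
  exact (((hcoord hU 0).mul (hcoord hV 0)).add ((hcoord hU 1).mul (hcoord hV 1))).sub
    ((hcoord hU 2).mul (hcoord hV 2))

/-! ### Maximal surfaces in isothermal coordinates -/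

/-- The coordinates of a conformal maximal immersion are harmonic. -/
lemma maximal_second_partials_add_eq_zero {Y : ℂ → EuclideanSpace ℝ (Fin 3)} {z : ℂ}
    (hY : ContDiffAt ℝ 2 Y z) (hpos : 0 < firstForm Y z 1 1)
    (hconf : ∀ᶠ w in 𝓝 z, firstForm Y w 1 1 = firstForm Y w Complex.I Complex.I ∧
      firstForm Y w 1 Complex.I = 0)
    (hmean : meanCurvature Y z = 0) :
    pderiv 1 (pderiv 1 Y) z + pderiv Complex.I (pderiv Complex.I Y) z = 0 := by
  obtain ⟨hE, hF⟩ := hconf.self_of_nhds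
  have hfd : DifferentiableAt ℝ (fderiv ℝ Y) z :=
    (hY.fderiv_right (m := 1) (by norm_num)).differentiableAt (by norm_num)
  have hd : ∀ a, DifferentiableAt ℝ (pderiv a Y) z := fun a =>
    hfd.clm_apply (differentiableAt_const a)
  have hsnd : ∀ a b, pderiv a (pderiv b Y) z = fderiv ℝ (fderiv ℝ Y) z a b := by
    intro a b
    unfold pderiv
    rw [fderiv_clm_apply hfd (differentiableAt_const b)]
    simp
  have hsymm : pderiv 1 (pderiv Complex.I Y) z = pderiv Complex.I (pderiv 1 Y) z := by
    rw [hsnd, hsnd]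
    exact (hY.isSymmSndFDerivAt (by simp)) 1 Complex.I
  have hdform : ∀ a b c, fderiv ℝ (fun w => firstForm Y w a b) z c =
      lorentz (pderiv c (pderiv a Y) z) (pderiv b Y z) +
        lorentz (pderiv a Y z) (pderiv c (pderiv b Y) z) :=
    fun a b c => fderiv_lorentz (hd a) (hd b) c
  have hdE : ∀ c, fderiv ℝ (fun w => firstForm Y w 1 1) z c =
      fderiv ℝ (fun w => firstForm Y w Complex.I Complex.I) z c := fun c => by
    rw [EventuallyEq.fderiv_eq (hconf.mono fun w hw => hw.1)]
  have hdF : ∀ c, fderiv ℝ (fun w => firstForm Y w 1 Complex.I) z c = 0 := fun c => by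
    rw [EventuallyEq.fderiv_eq (f := fun _ => (0 : ℝ)) (hconf.mono fun w hw => hw.2)]
    simp
  have e1 := hdE 1
  have eI := hdE Complex.I
  have f1 := hdF 1
  have fI := hdF Complex.I
  simp only [hdform, hsymm] at e1 eI f1 fI
  set a := pderiv 1 Y z with ha
  set b := pderiv Complex.I Y z with hb
  have hEab : lorentz a a = lorentz b b := hE
  have hFab : lorentz a b = 0 := hF
  have hpos' : 0 < lorentz a a := hpos
  have hdet : 0 < lorentz a a * lorentz b b - lorentz a b ^ 2 := by
    rw [hFab, ← hEab]; nlinarith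
  -- With `E`, `F`, `G` the coefficients of the first form, the component along `Y_u` vanishes by
  -- `E_u = G_u` and `F_v = 0`, and the one along `Y_v` by `E_v = G_v` and `F_u = 0`. The normal
  -- component is a nonzero multiple of the mean curvature.
  refine eq_zero_of_lorentz_eq_zero hdet.ne' ?_ ?_ ?_
  · rw [lorentz_add_left]
    rw [lorentz_comm a] at e1 fI
    rw [lorentz_comm b] at e1
    linarith
  · rw [lorentz_add_left]
    rw [lorentz_comm a] at eI f1
    rw [lorentz_comm b] at eI
    linarith
  · have hsq : 0 < Real.sqrt (-lorentz (lorentzCross a b) (lorentzCross a b)) := by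
      rw [Real.sqrt_pos, lorentzCross_self]; linarith
    have hform : ∀ c d, secondForm Y z c d =
        (Real.sqrt (-lorentz (lorentzCross a b) (lorentzCross a b)))⁻¹ *
          lorentz (pderiv c (pderiv d Y) z) (lorentzCross a b) := fun c d => by
      simp only [secondForm, unitNormal, lorentz_smul_right, ← ha, ← hb]
    have hnum := hmean
    rw [meanCurvature, div_eq_zero_iff] at hnum
    have hden : 2 * (firstForm Y z 1 1 * firstForm Y z Complex.I Complex.I
        - firstForm Y z 1 Complex.I ^ 2) ≠ 0 := by
      have : 0 < 2 * (lorentz a a * lorentz b b - lorentz a b ^ 2) := by linarith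
      exact this.ne'
    have hnum := hnum.resolve_right hden
    rw [hF, ← hE, hform, hform, hform] at hnum
    rw [lorentz_add_left]
    have : firstForm Y z 1 1 * (Real.sqrt (-lorentz (lorentzCross a b) (lorentzCross a b)))⁻¹ *
        (lorentz (pderiv 1 (pderiv 1 Y) z) (lorentzCross a b) +
          lorentz (pderiv Complex.I (pderiv Complex.I Y) z) (lorentzCross a b)) = 0 := by
      linarith
    exact (mul_eq_zero.1 this).resolve_left (by positivity)

lemma hasDerivAt_log_log {t : ℝ} (ht : 1 < t) :
    HasDerivAt (fun t => Real.log (Real.log t)) (t * Real.log t)⁻¹ t := by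
  have h0 : t ≠ 0 := by positivity
  have hL := Real.log_pos ht
  convert (Real.hasDerivAt_log h0).log hL.ne' using 1
  field_simp

lemma hasDerivAt_inv_mul_log {t : ℝ} (ht : 1 < t) :
    HasDerivAt (fun t => (t * Real.log t)⁻¹) (-(Real.log t + 1) / (t * Real.log t) ^ 2) t := by
  have h0 : t ≠ 0 := by positivity
  have hL := Real.log_pos ht
  have hmul : HasDerivAt (fun t => t * Real.log t) (1 * Real.log t + t * t⁻¹) t :=
    (hasDerivAt_id t).mul (Real.hasDerivAt_log h0)
  have hinv := hmul.fun_inv (mul_ne_zero h0 hL.ne')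
  rwa [one_mul, mul_inv_cancel₀ h0] at hinv

/-- On a maximal surface, `log (log ⟨X, X⟩)` is strictly superharmonic where `⟨X, X⟩ > 1`. -/
lemma maximal_log_log_superharmonic {Y : ℂ → EuclideanSpace ℝ (Fin 3)} {z : ℂ}
    (hY : ContDiffAt ℝ 2 Y z) (hpos : 0 < firstForm Y z 1 1)
    (hconf : ∀ᶠ w in 𝓝 z, firstForm Y w 1 1 = firstForm Y w Complex.I Complex.I ∧
      firstForm Y w 1 Complex.I = 0)
    (hmean : meanCurvature Y z = 0) (hq : 1 < lorentz (Y z) (Y z)) :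
    ContDiffAt ℝ 2 (fun w => Real.log (Real.log (lorentz (Y w) (Y w)))) z ∧
      Laplacian.laplacian (fun w => Real.log (Real.log (lorentz (Y w) (Y w)))) z < 0 := by
  have hqc : ContDiffAt ℝ 2 (fun w => lorentz (Y w) (Y w)) z := hY.lorentz hY
  have hL : 0 < Real.log (lorentz (Y z) (Y z)) := Real.log_pos hq
  have hc : ContDiffAt ℝ 2 (fun w => Real.log (Real.log (lorentz (Y w) (Y w)))) z :=
    (hqc.log (by positivity)).log hL.ne'
  refine ⟨hc, ?_⟩
  have hharm := maximal_second_partials_add_eq_zero hY hpos hconf hmean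
  obtain ⟨hE, hF⟩ := hconf.self_of_nhds
  have hfd : DifferentiableAt ℝ (fderiv ℝ Y) z :=
    (hY.fderiv_right (m := 1) (by norm_num)).differentiableAt (by norm_num)
  have hd : ∀ a, DifferentiableAt ℝ (pderiv a Y) z := fun a =>
    hfd.clm_apply (differentiableAt_const a)
  have hdiff : ∀ᶠ w in 𝓝 z, DifferentiableAt ℝ Y w :=
    (hY.eventually (by simp)).mono fun w hw => hw.differentiableAt (by norm_num)
  have hdq : ∀ a, (fun w => fderiv ℝ (fun w => lorentz (Y w) (Y w)) w a) =ᶠ[𝓝 z]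
      fun w => 2 * lorentz (Y w) (pderiv a Y w) := fun a => by
    filter_upwards [hdiff] with w hw
    rw [fderiv_lorentz hw hw, lorentz_comm, pderiv]; ring
  have hd2q : ∀ a, fderiv ℝ (fun w => fderiv ℝ (fun w => lorentz (Y w) (Y w)) w a) z a =
      2 * (lorentz (pderiv a Y z) (pderiv a Y z) + lorentz (pderiv a (pderiv a Y) z) (Y z)) := by
    intro a
    rw [(hdq a).fderiv_eq]
    have hdl : DifferentiableAt ℝ (fun w => lorentz (Y w) (pderiv a Y w)) z := by
      refine ContDiffAt.differentiableAt (n := 1) (ContDiffAt.lorentz (hY.of_le (by norm_num)) ?_)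
        (by norm_num)
      exact (hY.fderiv_right (m := 1) (by norm_num)).clm_apply contDiffAt_const
    rw [fderiv_const_mul hdl]
    simp only [smul_apply, smul_eq_mul]
    rw [fderiv_lorentz hdiff.self_of_nhds (hd a), lorentz_comm (Y z)]
    rfl
  have hφ : ∀ᶠ t in 𝓝 (lorentz (Y z) (Y z)),
      HasDerivAt (fun t => Real.log (Real.log t)) (t * Real.log t)⁻¹ t :=
    (lt_mem_nhds hq).mono fun t ht => hasDerivAt_log_log ht
  have hdq1 := (hdq 1).self_of_nhds
  have hdqI := (hdq Complex.I).self_of_nhds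
  beta_reduce at hdq1 hdqI
  rw [laplacian_eq_second_partials hc,
    fderiv_fderiv_comp hqc hφ (hasDerivAt_inv_mul_log hq), hd2q, hdq1,
    fderiv_fderiv_comp hqc hφ (hasDerivAt_inv_mul_log hq), hd2q, hdqI]
  have hsum : lorentz (pderiv 1 (pderiv 1 Y) z) (Y z) +
      lorentz (pderiv Complex.I (pderiv Complex.I Y) z) (Y z) = 0 := by
    rw [← lorentz_add_left, hharm]; simp [lorentz]
  have hgram := lorentz_gram (pderiv 1 Y z) (pderiv Complex.I Y z) (Y z)
  change lorentz (pderiv 1 Y z) (pderiv 1 Y z) =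
    lorentz (pderiv Complex.I Y z) (pderiv Complex.I Y z) at hE
  change lorentz (pderiv 1 Y z) (pderiv Complex.I Y z) = 0 at hF
  change 0 < lorentz (pderiv 1 Y z) (pderiv 1 Y z) at hpos
  rw [← hE, hF] at hgram
  rw [← hE]
  set l := lorentz (pderiv 1 Y z) (pderiv 1 Y z)
  set u := lorentz (Y z) (pderiv 1 Y z)
  set v := lorentz (Y z) (pderiv Complex.I Y z)
  set q := lorentz (Y z) (Y z)
  set L := Real.log q
  -- The Gram identity now reads `q l² = l (u² + v²) - ⟨Y, n⟩²` with `n = Y_u × Y_v`.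
  have hgrad : l * q ≤ u ^ 2 + v ^ 2 := by
    have : l * (l * q) ≤ l * (u ^ 2 + v ^ 2) := by
      nlinarith [sq_nonneg (lorentz (Y z) (lorentzCross (pderiv 1 Y z) (pderiv Complex.I Y z)))]
    exact le_of_mul_le_mul_left this hpos
  have hq0 : 0 < q := by linarith
  have hfrac : -(L + 1) / (q * L) ^ 2 * (4 * (u ^ 2 + v ^ 2)) ≤
      -(L + 1) / (q * L) ^ 2 * (4 * (l * q)) := by
    apply mul_le_mul_of_nonpos_left (by linarith)
    apply div_nonpos_of_nonpos_of_nonneg <;> [linarith; positivity]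
  -- For `log q` alone the two terms would cancel; the outer logarithm contributes the strictly
  -- negative remainder.
  have hval : -(L + 1) / (q * L) ^ 2 * (4 * (l * q)) + (q * L)⁻¹ * (4 * l) =
      -(4 * l / (q * L ^ 2)) := by
    field_simp; ring
  have hneg : 0 < 4 * l / (q * L ^ 2) := by positivity
  linear_combination hfrac + hval + hneg + 2 * (q * L)⁻¹ * hsum

/-! ### Properness and the conical region -/

lemma tan_sq_lt_one {α : ℝ} (hα : α ∈ Set.Ioo 0 (Real.pi / 4)) : Real.tan α ^ 2 < 1 := by
  have ht0 : 0 < Real.tan α :=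
    Real.tan_pos_of_pos_of_lt_pi_div_two hα.1 (by linarith [hα.2, Real.pi_pos])
  have ht1 : Real.tan α < 1 := by
    rw [← Real.tan_pi_div_four]
    exact Real.tan_lt_tan_of_lt_of_lt_pi_div_two (by linarith [hα.1, Real.pi_pos])
      (by linarith [Real.pi_pos]) hα.2
  nlinarith

/-- With `r² = x₀² + x₁²` and `t = tan² α < 1`, the cone gives `⟨x, x⟩ ≥ (1 - t) r²` and `‖x‖² ≤ (1
+ t) r² ≤ 2 r²`. -/
lemma lorentz_ge_of_mem_conicalRegion {α : ℝ} (hα : α ∈ Set.Ioo 0 (Real.pi / 4))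
    {x : EuclideanSpace ℝ (Fin 3)} (hx : x ∈ conicalRegion α) :
    (1 - Real.tan α ^ 2) / 2 * ‖x‖ ^ 2 ≤ lorentz x x := by
  have hsq : x 2 ^ 2 ≤ (x 0 ^ 2 + x 1 ^ 2) * Real.tan α ^ 2 := by
    have h : |x 2| ^ 2 ≤ (Real.sqrt (x 0 ^ 2 + x 1 ^ 2) * Real.tan α) ^ 2 :=
      pow_le_pow_left₀ (abs_nonneg _) hx 2
    rwa [sq_abs, mul_pow, Real.sq_sqrt (by positivity)] at h
  rw [EuclideanSpace.real_norm_sq_eq, Fin.sum_univ_three, lorentz]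
  have ht := tan_sq_lt_one hα
  -- The goal amounts to `(3 - t) x₂² ≤ (1 + t) r²`, and `1 + t = t (3 - t) + (1 - t)²`.
  have h1 := mul_le_mul_of_nonneg_right hsq (by linarith : 0 ≤ 3 - Real.tan α ^ 2)
  have h2 : 0 ≤ (x 0 ^ 2 + x 1 ^ 2) * (1 - Real.tan α ^ 2) ^ 2 := by positivity
  linarith

section Surface

variable {S : Type*} [TopologicalSpace S] {M B : Set S} {X : S → EuclideanSpace ℝ (Fin 3)}

lemma isCompact_norm_le (hproper : IsProperMap (M.domRestrict X)) (R : ℝ) :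
    IsCompact {p ∈ M | ‖X p‖ ≤ R} := by
  have h := (hproper.isCompact_preimage (isCompact_closedBall 0 R)).image continuous_subtype_val
  convert h using 1
  ext p
  simp [and_comm]

lemma exists_radius_lorentz_ge (hc : ContinuousOn X M) {α : ℝ} (hα : α ∈ Set.Ioo 0 (Real.pi / 4))
    (hcone : EventuallyOn M (fun p => X p ∈ conicalRegion α)) (A : ℝ) :
    ∃ R, ∀ p ∈ M, R ≤ ‖X p‖ → A ≤ lorentz (X p) (X p) := by
  obtain ⟨K, hKM, hK, hcone⟩ := hcone
  obtain ⟨C, hC⟩ := hK.exists_bound_of_continuousOn (hc.mono hKM)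
  have hδ : 0 < (1 - Real.tan α ^ 2) / 2 := by linarith [tan_sq_lt_one hα]
  set δ := (1 - Real.tan α ^ 2) / 2 with hδdef
  -- `C + 1` forces `p` out of `K`; the other two bounds give `δ ‖X p‖² ≥ δ ‖X p‖ ≥ A`.
  refine ⟨max (C + 1) (max 1 (A / δ)), fun p hp hR => ?_⟩
  have h1 : C + 1 ≤ ‖X p‖ := (le_max_left _ _).trans hR
  have h2 : 1 ≤ ‖X p‖ := ((le_max_left _ _).trans (le_max_right _ _)).trans hR
  have h3 : A / δ ≤ ‖X p‖ := ((le_max_right _ _).trans (le_max_right _ _)).trans hR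
  have hpK : p ∉ K := fun h => by linarith [hC p h]
  have hq := lorentz_ge_of_mem_conicalRegion hα (hcone p ⟨hp, hpK⟩)
  rw [div_le_iff₀ hδ] at h3
  nlinarith [mul_nonneg hδ.le (mul_nonneg (norm_nonneg (X p)) (sub_nonneg.2 h2))]

lemma IsSurfaceWithBoundary.isOpen_interior (hM : IsSurfaceWithBoundary M B) : IsOpen (M \ B) := by
  have : M \ B = interior M \ B := by
    ext p
    refine ⟨fun h => ⟨?_, h.2⟩, fun h => ⟨interior_subset h.1, h.2⟩⟩
    by_contra hp
    exact h.2 (hM.frontier_subset ⟨subset_closure h.1, hp⟩)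
  rw [this]
  exact _root_.isOpen_interior.sdiff hM.isClosed_boundary

lemma continuousOn_lorentz_self (hc : ContinuousOn X M) :
    ContinuousOn (fun p => lorentz (X p) (X p)) M := by
  unfold lorentz
  fun_prop

variable [ChartedSpace ℂ S]

/-! ### Maximum principles on the surface -/

lemma tendsto_chart_symm (p : S) :
    Tendsto (chartAt ℂ p).symm (𝓝 (chartAt ℂ p p)) (𝓝 p) := by
  simpa using (chartAt ℂ p).tendsto_symm (mem_chart_source ℂ p)

lemma IsLocalMax.comp_chart_symm {g : S → ℝ} {p : S} (h : IsLocalMax g p) :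
    IsLocalMax (g ∘ (chartAt ℂ p).symm) (chartAt ℂ p p) := by
  have := (tendsto_chart_symm p).eventually h
  simpa [IsLocalMax, IsMaxFilter] using this

lemma IsHarmonicOnSurface.harmonicAt {U : Set S} {f : S → ℝ} (hf : IsHarmonicOnSurface U f)
    {p : S} (hp : p ∈ U) :
    InnerProductSpace.HarmonicAt (f ∘ (chartAt ℂ p).symm) (chartAt ℂ p p) :=
  hf _ (chart_mem_atlas ℂ p) _ ⟨mem_chart_target ℂ p, by simpa using hp⟩

/-- A harmonic function on the surface is constant near an interior local maximum. -/
lemma IsHarmonicOnSurface.eventually_eq_of_isLocalMax {U : Set S} {f : S → ℝ}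
    (hf : IsHarmonicOnSurface U f) {p : S} (hp : p ∈ U) (hmax : IsLocalMax f p) :
    ∀ᶠ x in 𝓝 p, f x = f p := by
  have h := (hf.harmonicAt hp).eventually_eq_of_isLocalMax hmax.comp_chart_symm
  have hc := (chartAt ℂ p).continuousAt (mem_chart_source ℂ p)
  filter_upwards [hc.eventually h, (chartAt ℂ p).open_source.mem_nhds (mem_chart_source ℂ p)]
    with x hx hxs
  simpa [(chartAt ℂ p).left_inv hxs] using hx

/-- Subtracting a positive multiple of `log (log ⟨X, X⟩)` from a harmonic function leaves no
interior local maximum where `⟨X, X⟩ > 1`. -/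
lemma not_isLocalMax_sub_log_log (hM : IsSurfaceWithBoundary M B)
    (hX : IsConformalMaximalImmersion M B X) {f : S → ℝ} (hf : IsHarmonicOnSurface (M \ B) f)
    {ε : ℝ} (hε : 0 < ε) {p : S} (hp : p ∈ M \ B) (hq : 1 < lorentz (X p) (X p)) :
    ¬ IsLocalMax (fun x => f x - ε * Real.log (Real.log (lorentz (X x) (X x)))) p := by
  intro hmax
  set e := chartAt ℂ p with he
  have hat : e ∈ atlas ℂ S := chart_mem_atlas ℂ p
  have hsymm : e.symm (e p) = p := e.left_inv (mem_chart_source ℂ p)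
  have hz : e p ∈ e.target ∩ e.symm ⁻¹' (M \ B) :=
    ⟨mem_chart_target ℂ p, by simpa [hsymm] using hp⟩
  have hnear : ∀ᶠ w in 𝓝 (e p), w ∈ e.target ∩ e.symm ⁻¹' (M \ B) :=
    (e.isOpen_inter_preimage_symm hM.isOpen_interior).mem_nhds hz
  have hY : ContDiffAt ℝ 2 (X ∘ e.symm) (e p) := by
    have h := (contMDiffAt_iff.1 ((hX.smooth p hp).contMDiffAt
      (hM.isOpen_interior.mem_nhds hp))).2
    simp only [mfld_simps, contDiffWithinAt_univ] at h
    exact ContDiffAt.of_le h (by norm_cast)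
  have hconf : ∀ᶠ w in 𝓝 (e p),
      firstForm (X ∘ e.symm) w 1 1 = firstForm (X ∘ e.symm) w Complex.I Complex.I ∧
        firstForm (X ∘ e.symm) w 1 Complex.I = 0 :=
    hnear.mono fun w hw => hX.conformal e hat w hw
  obtain ⟨hsc, hsl⟩ := maximal_log_log_superharmonic hY
    (hX.spacelike e hat _ hz 1 one_ne_zero) hconf (hX.maximal e hat _ hz)
    (by simpa [hsymm] using hq)
  exact (hf.harmonicAt hp).not_isLocalMax_sub hsc hsl hε hmax.comp_chart_symm

/-- Maximum principle at infinity: an upper bound on a suitable compact sublevel set of `‖X‖`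
holds on all of `M`. -/
lemma le_of_le_on_norm_le (hM : IsSurfaceWithBoundary M B)
    (hX : IsConformalMaximalImmersion M B X) (hproper : IsProperMap (M.domRestrict X))
    (hlarge : ∀ A : ℝ, ∃ R, ∀ p ∈ M, R ≤ ‖X p‖ → A ≤ lorentz (X p) (X p))
    {f : S → ℝ} (hfc : ContinuousOn f M) (hf : IsHarmonicOnSurface (M \ B) f)
    {C : ℝ} (hC : ∀ p ∈ M, f p ≤ C) (hfB : ∀ p ∈ B, f p = 0) {R m : ℝ} (hm : 0 ≤ m)
    (hR : ∀ p ∈ M, R ≤ ‖X p‖ → Real.exp 1 ≤ lorentz (X p) (X p))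
    (hfm : ∀ p ∈ M, ‖X p‖ ≤ R → f p ≤ m) : ∀ p ∈ M, f p ≤ m := by
  intro p₀ hp₀
  by_cases hp₀R : ‖X p₀‖ ≤ R
  · exact hfm p₀ hp₀ hp₀R
  push Not at hp₀R
  set h : S → ℝ := fun p => Real.log (Real.log (lorentz (X p) (X p))) with hh
  have hlog : ∀ p ∈ M, R ≤ ‖X p‖ → 1 ≤ Real.log (lorentz (X p) (X p)) := fun p hp hpR => by
    rw [Real.le_log_iff_exp_le ((Real.exp_pos 1).trans_le (hR p hp hpR))]
    exact hR p hp hpR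
  have hone : ∀ p ∈ M, R ≤ ‖X p‖ → 1 < lorentz (X p) (X p) := fun p hp hpR =>
    (Real.one_lt_exp_iff.2 one_pos).trans_le (hR p hp hpR)
  have hnonneg : ∀ p ∈ M, R ≤ ‖X p‖ → 0 ≤ h p := fun p hp hpR => Real.log_nonneg (hlog p hp hpR)
  have key : ∀ ε > 0, f p₀ - ε * h p₀ ≤ m := by
    intro ε hε
    -- Beyond `R₁`, `h ≥ C / ε`, so `f - εh ≤ 0` on the outer edge of the compact shell `D`. On the
    -- inner edge `f ≤ m` and `h ≥ 0` suffice.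
    obtain ⟨R₁, hR₁⟩ := hlarge (Real.exp (Real.exp (C / ε)))
    set R₂ := max R₁ (‖X p₀‖ + 1)
    set D : Set S := {p ∈ M | ‖X p‖ ≤ R₂} ∩ {p ∈ M | R ≤ ‖X p‖}
    have hDM : D ⊆ M := fun p hp => hp.1.1
    have hDc : IsCompact D := (isCompact_norm_le hproper R₂).inter_right
      (hX.continuousOn.norm.preimage_isClosed_of_isClosed hM.isClosed isClosed_Ici)
    have hcont : ContinuousOn (fun p => f p - ε * h p) D := by
      refine (hfc.mono hDM).sub (continuousOn_const.mul ?_)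
      refine (((continuousOn_lorentz_self hX.continuousOn).mono hDM).log fun p hp => ?_).log
        fun p hp => ?_
      · linarith [hone p hp.1.1 hp.2.2]
      · linarith [hlog p hp.1.1 hp.2.2]
    have hp₀D : p₀ ∈ D :=
      ⟨⟨hp₀, (by linarith : ‖X p₀‖ ≤ ‖X p₀‖ + 1).trans (le_max_right _ _)⟩, hp₀, hp₀R.le⟩
    obtain ⟨p, hpD, hpmax⟩ := hDc.exists_isMaxOn ⟨p₀, hp₀D⟩ hcont
    refine (hpmax hp₀D).trans ?_
    have hpM := hDM hpD
    have hhp := mul_nonneg hε.le (hnonneg p hpM hpD.2.2)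
    change f p - ε * h p ≤ m
    by_cases hpB : p ∈ B
    · rw [hfB p hpB]; linarith
    rcases hpD.2.2.eq_or_lt with heq | hlt
    · linarith [hfm p hpM heq.ge]
    rcases hpD.1.2.eq_or_lt with heq | hlt'
    · have hq := hR₁ p hpM (heq ▸ le_max_left _ _)
      have h1 : Real.exp (C / ε) ≤ Real.log (lorentz (X p) (X p)) := by
        rwa [Real.le_log_iff_exp_le ((Real.exp_pos _).trans_le hq)]
      have h2 : C / ε ≤ h p := by
        rwa [hh, Real.le_log_iff_exp_le ((Real.exp_pos _).trans_le h1)]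
      rw [div_le_iff₀ hε] at h2
      linarith [hC p hpM]
    · exfalso
      have hU : M \ B ∈ 𝓝 p := hM.isOpen_interior.mem_nhds ⟨hpM, hpB⟩
      have hXp : ContinuousAt (fun x => ‖X x‖) p :=
        (hX.continuousOn.continuousAt (mem_of_superset hU Set.sdiff_subset)).norm
      refine not_isLocalMax_sub_log_log hM hX hf hε ⟨hpM, hpB⟩ (hone p hpM hpD.2.2) ?_
      filter_upwards [hU, hXp.eventually (lt_mem_nhds hlt), hXp.eventually (gt_mem_nhds hlt')]
        with x hx hx1 hx2
      exact hpmax (⟨⟨hx.1, hx2.le⟩, hx.1, hx1.le⟩ : x ∈ D)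
  refine le_of_forall_pos_le_add fun δ hδ => ?_
  have hpos : 0 < h p₀ + 1 := by linarith [hnonneg p₀ hp₀ hp₀R.le]
  -- The `+ 1` covers the case `h p₀ = 0`.
  have hk := key (δ / (h p₀ + 1)) (by positivity)
  have : δ / (h p₀ + 1) * h p₀ ≤ δ := by
    rw [div_mul_eq_mul_div, div_le_iff₀ hpos]
    nlinarith
  linarith

/-- A positive value would give a global maximum, attained on a compact sublevel set of `‖X‖`; its
level set is clopen and avoids `B`. -/
lemma harmonic_nonpos_of_boundary_zero [ConnectedSpace S] (hM : IsSurfaceWithBoundary M B)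
    (hB : B.Nonempty) (hX : IsConformalMaximalImmersion M B X)
    (hproper : IsProperMap (M.domRestrict X))
    (hlarge : ∀ A : ℝ, ∃ R, ∀ p ∈ M, R ≤ ‖X p‖ → A ≤ lorentz (X p) (X p))
    {f : S → ℝ} (hfc : ContinuousOn f M) (hf : IsHarmonicOnSurface (M \ B) f)
    {C : ℝ} (hC : ∀ p ∈ M, f p ≤ C) (hfB : ∀ p ∈ B, f p = 0) : ∀ p ∈ M, f p ≤ 0 := by
  by_contra! hcon
  obtain ⟨p₁, hp₁M, hp₁⟩ := hcon
  obtain ⟨R₁, hR₁⟩ := hlarge (Real.exp 1)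
  -- Including `p₁` makes the maximum over the sublevel set positive.
  set R := max R₁ ‖X p₁‖
  have hKc := isCompact_norm_le hproper R
  have hp₁K : p₁ ∈ {p ∈ M | ‖X p‖ ≤ R} := ⟨hp₁M, le_max_right _ _⟩
  obtain ⟨p, hpK, hpmax⟩ := hKc.exists_isMaxOn ⟨p₁, hp₁K⟩ (hfc.mono fun x hx => hx.1)
  have hfp : 0 < f p := hp₁.trans_le (hpmax hp₁K)
  have hle : ∀ x ∈ M, f x ≤ f p := le_of_le_on_norm_le hM hX hproper hlarge hfc hf hC hfB hfp.le
    (fun x hx hxR => hR₁ x hx ((le_max_left _ _).trans hxR)) fun x hx hxR => hpmax ⟨hx, hxR⟩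
  -- Lying in the open set `M \ B` makes the level set open in `S`, not merely relative to `M`.
  have hAsub : M ∩ f ⁻¹' {f p} ⊆ M \ B := fun x hx =>
    ⟨hx.1, fun hxB => hfp.ne' (by rw [← hfB x hxB]; exact hx.2.symm)⟩
  have hAclosed : IsClosed (M ∩ f ⁻¹' {f p}) :=
    hfc.preimage_isClosed_of_isClosed hM.isClosed isClosed_singleton
  have hAopen : IsOpen (M ∩ f ⁻¹' {f p}) := by
    rw [isOpen_iff_mem_nhds]
    intro x hx
    have hU := hM.isOpen_interior.mem_nhds (hAsub hx)
    have hxp : f x = f p := hx.2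
    have hmax : IsLocalMax f x := by
      filter_upwards [hU] with y hy
      rw [hxp]; exact hle y hy.1
    filter_upwards [hU, hf.eventually_eq_of_isLocalMax (hAsub hx) hmax] with y hy hyx
    exact ⟨hy.1, hyx.trans hxp⟩
  have huniv := IsClopen.eq_univ ⟨hAclosed, hAopen⟩ ⟨p, hpK.1, rfl⟩
  obtain ⟨b, hb⟩ := hB
  exact (hAsub (huniv ▸ Set.mem_univ b)).2 hb

end Surface

theorem mainTheorem5 {S : Type*} [TopologicalSpace S] [T2Space S] [ConnectedSpace S]
    [ChartedSpace ℂ S] [IsManifold 𝓘(ℂ) ω S]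
    (M B : Set S) (hM : IsSurfaceWithBoundary M B) (hB : B.Nonempty)
    (X : S → EuclideanSpace ℝ (Fin 3)) (hX : IsConformalMaximalImmersion M B X)
    (hproper : IsProperMap (M.domRestrict X))
    (α : ℝ) (hα : α ∈ Set.Ioo 0 (Real.pi / 4))
    (hcone : EventuallyOn M (fun p => X p ∈ conicalRegion α)) :
    IsRelativeParabolic M B := by
  intro f hfc hf ⟨C, hC⟩ hfB p hp
  have hlarge := exists_radius_lorentz_ge hX.continuousOn hα hcone
  have hneg : IsHarmonicOnSurface (M \ B) (-f) := fun e he => (hf e he).neg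
  have h1 := harmonic_nonpos_of_boundary_zero hM hB hX hproper hlarge hfc hf
    (fun x hx => (le_abs_self _).trans (hC x hx)) hfB p hp
  have h2 := harmonic_nonpos_of_boundary_zero hM hB hX hproper hlarge hfc.neg hneg
    (fun x hx => (neg_le_abs _).trans (hC x hx)) (fun x hx => by simp [hfB x hx]) p hp
  rw [Pi.neg_apply] at h2
  linarith
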